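/- Let $p,q\ge 1$ and $0\le n\le pq$ be integers. Let $C(n;p,q)\subset\mathbb R^{2n}$ be the set of all $(x_1,y_1,\dots,x_n,y_n)$ with $1\le x_k\le p$, $1\le y_k\le q$ for all $k$, and $|x_k-x_\ell|\ge 1$ or $|y_k-y_\ell|\ge 1$ for all $k<\ell$ (the centers of $n$ labeled unit squares in a $p\times q$ rectangle). Give $([1,p]\times[1,q])^n$ its standard cubical structure with vertices at the integer points, and let $X(n;p,q)$ be the subcomplex of all cells that are contained in $C(n;p,q)$. A cell is an $n$-tuple of products of two intervals $[a_k,b_k]\times[c_k,d_k]$ with integer endpoints and $b_k-a_k,\,d_k-c_k\in\{0,1\}$; we say that its $k$-th piece is at $(b_k,d_k)$, has width $b_k-a_k+1$ and height $d_k-c_k+1$. The apex of the cell is its $0$-dimensional face $(b_1,d_1,\dots,b_n,d_n)$. The group $S_n$ acts on cells by permuting the labels of the pieces. A discrete vector field is a set $V$ of pairs $(f,e)$ of cells, $f$ a codimension one face of $e$, such that every cell lies in at most one pair; the two cells of a pair are called matched, and unmatched cells are called critical. It is a discrete gradient vector field (in Forman's sense) if there is no closed path $f_0,e_0,f_1,e_1,\dots,e_{r-1},f_r=f_0$,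 $r\ge1$, with $(f_i,e_i)\in V$ and $f_{i+1}\ne f_i$ a codimension one face of $e_i$ for all $i<r$. For a finite set $S\subset\mathbb{Z}_{\ge 0}^2$, the apex graph of $S$ is defined as follows. For each $(i,j)\in S$, the point $(i-\frac12,j)$ is a vertex if $i>1$ and $(i-1,j)\notin S$, and the point $(i,j-\frac12)$ is a vertex if $j>1$ and $(i,j-1)\notin S$. Two vertices $(i-\frac12,j)$ and $(i,j-\frac12)$ are adjacent if $(i-1,j-1)\in S$; two vertices $(i-\frac12,j)$ and $(i-1,j+\frac12)$ are always adjacent; there are no other edges. The apex graph of a cell is that of the set $S$ of locations $(b_k,d_k)$ of its pieces; it depends only on the apex. **Theorem.** (a) The apex graph of every cell of $X(n;p,q)$ is a disjoint union of path graphs. (b) For each $0$-cell $a$ of $X(n;p,q)$, send a cell $e$ with apex $a$ to the set that contains $(i-\frac12,j)$ for each piece of $e$ of width $2$ at $(i,j)$ and $(i,j-\frac12)$ for each piece of $e$ of height $2$ at $(i,j)$. This is a bijection from the set of cells with apex $a$ to the set of independent sets of the apex graph of $a$, and for cells $f,e$ with apex $a$, $f$ is a face of $e$ if and only if the set of $f$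 is contained in the set of $e$. (c) There is a discrete gradient vector field $V$ on $X(n;p,q)$ with the following properties. 1. If $(f,e)\in V$, then $f$ and $e$ have the same apex. 2. Among the cells with a given apex, at most one is critical. 3. $V$ is $S_n$-equivariant: if $(f,e)\in V$ and $\pi\in S_n$, then $(\pi f,\pi e)\in V$. 4. $V$ is built from independent sets of the apex graphs: for each finite $S\subset\mathbb Z_{\ge0}^2$ there is a matching on the independent sets of the apex graph of $S$, such that matched sets differ by exactly one vertex and at most one independent set is unmatched, and $(f,e)\in V$ if and only if $f$ and $e$ have the same apex and the independent set of $f$ is matched with that of $e$ as the smaller one with the larger one. -/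

import Mathlib

namespace HardSquares

/-! ### Discrete vector fields on a complex given by its cells, face relation and dimension -/

/-- `f` is a face of `e` of codimension one. -/
def IsFacet {K : Type*} (face : K → K → Prop) (dim : K → ℕ) (f e : K) : Prop :=
  face f e ∧ dim e = dim f + 1

/-- A discrete vector field (Forman): a set of pairs `(f, e)`, written `V f e`, such that `f` is a
codimension one face of `e`, and every cell lies in at most one pair. -/
structure IsDiscreteVectorField {K : Type*} (face : K → K → Prop) (dim : K → ℕ)
    (V : K → K → Prop) : Prop where
  facet : ∀ f e, V f e → IsFacet face dim f e
  disjoint : ∀ f e f' e', V f e → V f' e' →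
    (f = f' ∨ f = e' ∨ e = f' ∨ e = e') → f = f' ∧ e = e'

/-- One step `f, e, f'` of a gradient path: `f` is matched with `e`, and `f' ≠ f` is another
codimension one face of `e`. -/
def VStep {K : Type*} (face : K → K → Prop) (dim : K → ℕ) (V : K → K → Prop) (f f' : K) : Prop :=
  ∃ e, V f e ∧ IsFacet face dim f' e ∧ f' ≠ f

/-- A discrete gradient vector field: a discrete vector field without nontrivial closed paths. -/
structure IsDiscreteGradient {K : Type*} (face : K → K → Prop) (dim : K → ℕ)
    (V : K → K → Prop) : Prop extends IsDiscreteVectorField face dim V where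
  acyclic : ∀ f, ¬ Relation.TransGen (VStep face dim V) f f

/-- A cell is critical if it belongs to no pair. -/
def IsCritical {K : Type*} (V : K → K → Prop) (c : K) : Prop :=
  ∀ d, ¬ V c d ∧ ¬ V d c

/-! ### The configuration space and the cubical complex -/

/-- The configuration space of `n` labeled unit squares in a `p` by `q` rectangle, in terms of the
coordinates `z k = (x_k, y_k)` of the centers. -/
def configSpace (n p q : ℕ) : Set (Fin n → ℝ × ℝ) :=
  {z | (∀ k, (1 ≤ (z k).1 ∧ (z k).1 ≤ p) ∧ (1 ≤ (z k).2 ∧ (z k).2 ≤ q)) ∧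
    ∀ k l, k < l → 1 ≤ |(z k).1 - (z l).1| ∨ 1 ≤ |(z k).2 - (z l).2|}

/-- The cells of the interval `[1, m]` subdivided at the integers: the points `{left}`
(`right = left`) and the edges `[left, left + 1]` (`right = left + 1`). -/
@[ext]
structure GridInterval (m : ℕ) where
  left : ℕ
  right : ℕ
  one_le_left : 1 ≤ left
  right_le : right ≤ m
  right_eq : right = left ∨ right = left + 1

/-- The right endpoint of a cell of `[1, m]`, as a `0`-cell. -/
def GridInterval.top {m : ℕ} (I : GridInterval m) : GridInterval m where
  left := I.right
  right := I.right
  one_le_left := by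
    have h1 := I.one_le_left
    have h2 := I.right_eq
    omega
  right_le := I.right_le
  right_eq := Or.inl rfl

/-- A cell of the cubical complex `([1, p] × [1, q])ⁿ`: an `n`-tuple of coordinate grid cells.
The `k`-th piece of its rectangle arrangement consists of the board squares with centers in
`[left, right] × [left, right]`. -/
abbrev AmbientCell (n p q : ℕ) : Type := Fin n → GridInterval p × GridInterval q

/-- The closed cell in `ℝ²ⁿ`. -/
def AmbientCell.closedCell {n p q : ℕ} (σ : AmbientCell n p q) : Set (Fin n → ℝ × ℝ) :=
  {z | ∀ k, (z k).1 ∈ Set.Icc ((σ k).1.left : ℝ) ((σ k).1.right : ℝ) ∧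
    (z k).2 ∈ Set.Icc ((σ k).2.left : ℝ) ((σ k).2.right : ℝ)}

/-- The cells of the complex `X(n;p,q)`: the cells of `([1, p] × [1, q])ⁿ` that are fully contained
in the configuration space. -/
def Cell (n p q : ℕ) : Type :=
  {σ : AmbientCell n p q // σ.closedCell ⊆ configSpace n p q}

namespace Cell

variable {n p q : ℕ}

/-- `f` is a face of `e`: the closed cell of `f` is contained in that of `e`. -/
def IsFace (f e : Cell n p q) : Prop := f.1.closedCell ⊆ e.1.closedCell

/-- The dimension of a cell: the number of directions in which its pieces are extended. -/
def dim (e : Cell n p q) : ℕ :=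
  ∑ k, (((e.1 k).1.right - (e.1 k).1.left) + ((e.1 k).2.right - (e.1 k).2.left))

/-- The apex of a cell: the `0`-dimensional face in which every piece is replaced by its
upper-right corner square. -/
def apex (e : Cell n p q) : Cell n p q :=
  ⟨fun k => ((e.1 k).1.top, (e.1 k).2.top), by
    intro z hz
    apply e.2
    intro k
    have hx : (((e.1 k).1.left : ℕ) : ℝ) ≤ ((e.1 k).1.right : ℝ) := by
      have := (e.1 k).1.right_eq
      exact_mod_cast (by omega : (e.1 k).1.left ≤ (e.1 k).1.right)
    have hy : (((e.1 k).2.left : ℕ) : ℝ) ≤ ((e.1 k).2.right : ℝ) := by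
      have := (e.1 k).2.right_eq
      exact_mod_cast (by omega : (e.1 k).2.left ≤ (e.1 k).2.right)
    exact ⟨⟨hx.trans (hz k).1.1, (hz k).1.2⟩, ⟨hy.trans (hz k).2.1, (hz k).2.2⟩⟩⟩

/-- The action of a permutation on the labels: the piece with label `k` gets the label `π k`. -/
def relabel (π : Equiv.Perm (Fin n)) (e : Cell n p q) : Cell n p q :=
  ⟨fun k => e.1 (π.symm k), by
    intro z hz
    have h : (fun k => z (π k)) ∈ configSpace n p q := by
      apply e.2
      intro k
      simpa using hz (π k)
    refine ⟨fun k => by simpa using h.1 (π.symm k), fun k l hkl => ?_⟩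
    rcases lt_trichotomy (π.symm k) (π.symm l) with hlt | heq | hgt
    · simpa using h.2 _ _ hlt
    · exact absurd (π.symm.injective heq) hkl.ne
    · have h2 := h.2 _ _ hgt
      simp only [Equiv.apply_symm_apply] at h2
      rwa [abs_sub_comm (z k).1, abs_sub_comm (z k).2]⟩

/-- The location `(i, j)` of piece `k`: column and row of its upper-right corner square. -/
def pos (e : Cell n p q) (k : Fin n) : ℕ × ℕ := ((e.1 k).1.right, (e.1 k).2.right)

/-- The set of locations of the pieces (that is, of board squares occupied in the apex). -/
def occupied (e : Cell n p q) : Finset (ℕ × ℕ) := Finset.univ.image e.pos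

end Cell

/-! ### The apex graph -/

/-- The two directions in which a piece can extend from its upper-right corner square. -/
inductive Dir
  | left
  | down

/-- `((i, j), left)` stands for the point `(i - 1/2, j)`, the center of the left edge of the board
square `(i, j)`, and `((i, j), down)` for `(i, j - 1/2)`, the center of its lower edge. -/
abbrev EdgeMidpoint : Type := (ℕ × ℕ) × Dir

/-- The vertices of the apex graph for pieces at the locations in `S`. -/
def apexVertices (S : Finset (ℕ × ℕ)) : Set EdgeMidpoint :=
  {v | v.1 ∈ S ∧
    match v.2 with
    | Dir.left => 1 < v.1.1 ∧ (v.1.1 - 1, v.1.2) ∉ S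
    | Dir.down => 1 < v.1.2 ∧ (v.1.1, v.1.2 - 1) ∉ S}

/-- The edges of the apex graph, both of them only between vertices of the apex graph:
`(i + 1/2, j + 1)` and `(i + 1, j + 1/2)` are joined if there is a piece at `(i, j)`, and
`(i + 1/2, j)` and `(i, j + 1/2)` are always joined. -/
inductive ApexConflict (S : Finset (ℕ × ℕ)) : EdgeMidpoint → EdgeMidpoint → Prop
  | same (i j : ℕ) : (i, j) ∈ S →
      ApexConflict S ((i + 1, j + 1), Dir.left) ((i + 1, j + 1), Dir.down)
  | diag (i j : ℕ) : ApexConflict S ((i + 1, j), Dir.left) ((i, j + 1), Dir.down)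

/-- The apex graph for pieces at the locations in `S`. -/
def apexGraph (S : Finset (ℕ × ℕ)) : SimpleGraph (apexVertices S) :=
  SimpleGraph.fromRel fun v w => ApexConflict S v.1 w.1

/-- The independent sets of the apex graph, as sets of edge midpoints. -/
def apexIndepSets (S : Finset (ℕ × ℕ)) : Set (Set EdgeMidpoint) :=
  {I | ∃ J : Set (apexVertices S), (apexGraph S).IsIndepSet J ∧ I = Subtype.val '' J}

/-- A graph is a disjoint union of paths if each component is isomorphic to a path graph. -/
def IsDisjointUnionOfPaths {V : Type*} (G : SimpleGraph V) : Prop :=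
  ∀ c : G.ConnectedComponent, ∃ k : ℕ, Nonempty (c.toSimpleGraph ≃g SimpleGraph.pathGraph k)

/-- A matching on the independent sets of the apex graph such that matched sets differ by one
vertex (the pair `μ I J` having `J` as its larger member), and at most one independent set is
unmatched. -/
structure IsIndepSetMatching (S : Finset (ℕ × ℕ))
    (μ : Set EdgeMidpoint → Set EdgeMidpoint → Prop) : Prop where
  adjacent : ∀ I J, μ I J →
    I ∈ apexIndepSets S ∧ J ∈ apexIndepSets S ∧ ∃ v, v ∉ I ∧ J = insert v I
  disjoint : ∀ I J I' J', μ I J → μ I' J' →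
    (I = I' ∨ I = J' ∨ J = I' ∨ J = J') → I = I' ∧ J = J'
  unmatched : ∀ I ∈ apexIndepSets S, ∀ J ∈ apexIndepSets S,
    IsCritical μ I → IsCritical μ J → I = J

/-- The directions in which the pieces of a cell extend: `((i, j), left)` if the piece at `(i, j)`
has width `2`, and `((i, j), down)` if it has height `2`. -/
def Cell.extensions {n p q : ℕ} (e : Cell n p q) : Set EdgeMidpoint :=
  {v | ∃ k, e.pos k = v.1 ∧
    match v.2 with
    | Dir.left => (e.1 k).1.right = (e.1 k).1.left + 1
    | Dir.down => (e.1 k).2.right = (e.1 k).2.left + 1}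

end HardSquares

open HardSquares

namespace HardSquares

/-! ### Graphs whose edges join consecutive integers -/

/-! Every edge of an apex graph stays on one antidiagonal `i + j = const` and changes the height `j
- i` (suitably normalized) by exactly one, and antidiagonal and height together determine the
midpoint. So each component is a connected graph on distinct integers whose edges join consecutive
integers, that is, a path. A vertex of minimal height in any finite set has at most one neighbor
there, so the graph can be treated as a forest with a hereditary supply of leaves.

A closed cell lies in the configuration space exactly when its pieces cover pairwise disjoint sets
of board squares (`closedCell_subset_configSpace`). With the upper-right corners fixed, a cell is
recorded by which pieces extend left or down, and the vertices and edges of the apex graph list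
precisely the ways in which such extensions can leave the board or collide
(`extensions_mem_apexIndepSets`, `exists_cell_of_indepIn`). Faces with the same apex then correspond
to inclusion.

For the vector field, the independent sets of a forest are matched by recursion on leaves
(`exists_isRankedMatching`). The recursion also produces a rank that drops along gradient paths.
Cells with the same apex are paired accordingly. A gradient path either stays at one apex, where the
rank drops, or passes to a face with a different apex, whose coordinate sum is smaller. The
lexicographic potential excludes closed paths (`isDiscreteGradient_matchedBy`). Equivariance is
automatic, because the matching sees only the unlabeled locations and extensions. -/

theorem exists_adj_crossing {V : Type*} {G : SimpleGraph V} {P : V → Prop} {v w : V}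
    (h : G.Reachable v w) (hv : P v) (hw : ¬ P w) : ∃ a b, G.Adj a b ∧ P a ∧ ¬ P b := by
  by_contra! hcon
  obtain ⟨p⟩ := h
  induction p with
  | nil => exact hw hv
  | cons hadj _ ih => exact ih (hcon _ _ hadj hv) hw

/-- A finite connected graph on a set of integers all of whose edges join consecutive integers is
a path. -/
theorem nonempty_iso_pathGraph {V : Type*} [Finite V] {G : SimpleGraph V} (hG : G.Preconnected)
    (m : V → ℤ) (hm : Function.Injective m)
    (hadj : ∀ v w, G.Adj v w → m w = m v + 1 ∨ m v = m w + 1) :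
    ∃ k, Nonempty (G ≃g SimpleGraph.pathGraph k) := by
  classical
  have := Fintype.ofFinite V
  let _ : LinearOrder V := LinearOrder.lift' m hm
  have hlt : ∀ v w : V, v < w ↔ m v < m w := fun _ _ => Iff.rfl
  -- The covering relation of the order by `m` is adjacency, so `G` is the Hasse diagram of a finite
  -- linear order, as is a path graph.
  have hcov : ∀ v w : V, v ⋖ w ↔ G.Adj v w ∧ v < w := by
    intro v w
    constructor
    · intro h
      -- Some edge must leave the set of vertices up to `v`. It rises by one and no vertex lies
      -- strictly between `v` and `w`, so it is the edge from `v` to `w`.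
      obtain ⟨a, b, hab, ha, hb⟩ := exists_adj_crossing (P := fun u => m u ≤ m v) (hG v w) le_rfl
        (not_le.2 h.1)
      have hwb : m w ≤ m b := by
        by_contra hc
        exact h.2 ((hlt _ _).2 (not_le.1 hb)) ((hlt _ _).2 (not_le.1 hc))
      have hvw := (hlt _ _).1 h.1
      have h1 := hadj a b hab
      have hav : a = v := hm (by omega)
      have hbw : b = w := hm (by omega)
      exact ⟨hav ▸ hbw ▸ hab, h.1⟩
    · rintro ⟨h, hvw⟩
      refine ⟨hvw, fun u hu hu' => ?_⟩
      have h1 := hadj v w h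
      rw [hlt] at hu hu' hvw
      omega
  let φ : V ≃o Fin (Fintype.card V) := (Fintype.orderIsoFinOfCardEq V rfl).symm
  refine ⟨Fintype.card V, ⟨⟨φ.toEquiv, ?_⟩⟩⟩
  intro v w
  change (SimpleGraph.hasse _).Adj (φ v) (φ w) ↔ _
  rw [SimpleGraph.hasse_adj, apply_covBy_apply_iff, apply_covBy_apply_iff, hcov, hcov,
    G.adj_comm w v]
  constructor
  · rintro (h | h) <;> exact h.1
  · intro h
    rcases lt_or_gt_of_ne h.ne with h' | h'
    · exact Or.inl ⟨h, h'⟩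
    · exact Or.inr ⟨h, h'⟩

/-! ### Acyclic matchings on independent sets of forests -/

/-- A set of vertices is independent for the relation `r` and contained in `W`. -/
def IndepIn {α : Type*} (r : α → α → Prop) (W I : Set α) : Prop :=
  I ⊆ W ∧ ∀ v ∈ I, ∀ w ∈ I, ¬ r v w

theorem IndepIn.mono {α : Type*} {r : α → α → Prop} {W I J : Set α} (hJ : IndepIn r W J)
    (h : I ⊆ J) : IndepIn r W I :=
  ⟨h.trans hJ.1, fun v hv w hw => hJ.2 v (h hv) w (h hw)⟩

/-- A matching on the independent sets in `W`, with at most one unmatched set, whose gradient paths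
strictly decrease `ρ`. -/
structure IsRankedMatching {α : Type*} (r : α → α → Prop) (W : Set α)
    (M : Set α → Set α → Prop) (ρ : Set α → ℕ) : Prop where
  adjacent : ∀ I J, M I J → IndepIn r W I ∧ IndepIn r W J ∧ ∃ v, v ∉ I ∧ J = insert v I
  disjoint : ∀ I J I' J', M I J → M I' J' →
    (I = I' ∨ I = J' ∨ J = I' ∨ J = J') → I = I' ∧ J = J'
  unmatched : ∀ I J, IndepIn r W I → IndepIn r W J → IsCritical M I → IsCritical M J → I = J
  rank : ∀ I J I' u, M I J → u ∉ I' → J = insert u I' → I' ≠ I → ρ I' < ρ I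

theorem isRankedMatching_empty {α : Type*} (r : α → α → Prop) :
    IsRankedMatching r ∅ (fun _ _ => False) (fun _ => 0) where
  adjacent _ _ h := h.elim
  disjoint _ _ _ _ h := h.elim
  unmatched I J hI hJ _ _ := by
    rw [Set.subset_empty_iff.1 hI.1, Set.subset_empty_iff.1 hJ.1]
  rank _ _ _ _ h := h.elim

/-- If `v` has no neighbor in `W`, toggling `v` is a complete matching. -/
theorem isRankedMatching_isolated {α : Type*} {r : α → α → Prop} (hs : ∀ a b, r a b → r b a)
    (hi : ∀ a, ¬ r a a) {W : Set α} {v : α} (hv : v ∈ W) (hiso : ∀ w ∈ W, ¬ r v w) :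
    ∃ M ρ, IsRankedMatching r W M ρ := by
  classical
  refine ⟨fun I J => IndepIn r W J ∧ v ∉ I ∧ J = insert v I, fun I => if v ∈ I then 0 else 1,
    ?_, ?_, ?_, ?_⟩
  · rintro I J ⟨hJ, hvI, rfl⟩
    exact ⟨hJ.mono (Set.subset_insert _ _), hJ, v, hvI, rfl⟩
  · rintro I J I' J' ⟨-, h1, rfl⟩ ⟨-, h2, rfl⟩ h
    have h3 : I = I' := by
      rcases h with h | h | h | h
      · exact h
      · exact absurd (h ▸ Set.mem_insert _ _) h1
      · exact absurd (h ▸ Set.mem_insert _ _) h2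
      · rw [← Set.insert_sdiff_self_of_notMem h1, h, Set.insert_sdiff_self_of_notMem h2]
    exact ⟨h3, by rw [h3]⟩
  · intro I J hI _ hc _
    exfalso
    by_cases hvI : v ∈ I
    · exact (hc (I \ {v})).2 ⟨hI, by simp, by simp [Set.insert_eq_of_mem hvI]⟩
    · refine (hc (insert v I)).1 ⟨⟨Set.insert_subset hv hI.1, ?_⟩, hvI, rfl⟩
      rintro a (rfl | ha) b (rfl | hb)
      · exact hi _
      · exact hiso _ (hI.1 hb)
      · exact fun h => hiso _ (hI.1 ha) (hs _ _ h)
      · exact hI.2 a ha b hb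
  · rintro I J I' u ⟨-, h1, rfl⟩ hu h hne
    -- A step adds `v` and must remove some other vertex, so it ends at a set containing `v`.
    have hvI' : v ∈ I' := by
      have h2 : v ∈ insert u I' := h ▸ Set.mem_insert _ _
      rcases h2 with rfl | h2
      · refine absurd ?_ hne
        rw [← Set.insert_sdiff_self_of_notMem h1, h, Set.insert_sdiff_self_of_notMem hu]
      · exact h2
    simp [h1, hvI']

/-- This is the link of `w` in the independence complex, to which the recursion passes. -/
theorem indepIn_insert {α : Type*} {r : α → α → Prop} (hs : ∀ a b, r a b → r b a)
    (hi : ∀ a, ¬ r a a) {W I : Set α} {w : α} (hw : w ∈ W) (hI : w ∉ I) :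
    IndepIn r W (insert w I) ↔ IndepIn r {x ∈ W | x ≠ w ∧ ¬ r w x} I := by
  constructor
  · intro h
    refine ⟨fun x hx => ⟨h.1 (Or.inr hx), fun e => hI (e ▸ hx), ?_⟩, fun a ha b hb => ?_⟩
    · exact h.2 w (Or.inl rfl) x (Or.inr hx)
    · exact h.2 a (Or.inr ha) b (Or.inr hb)
  · intro h
    refine ⟨Set.insert_subset hw fun x hx => (h.1 hx).1, ?_⟩
    rintro a (rfl | ha) b (rfl | hb)
    · exact hi _
    · exact (h.1 hb).2.2
    · exact fun h' => (h.1 ha).2.2 (hs _ _ h')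
    · exact h.2 a ha b hb

/-- If `w` is the only neighbor of `v` in `W`, the independent sets without `w` are matched by
toggling `v`, and those with `w` by a matching for the vertices not adjacent to `w`. -/
theorem isRankedMatching_leaf {α : Type*} {r : α → α → Prop} (hs : ∀ a b, r a b → r b a)
    (hi : ∀ a, ¬ r a a) {W : Set α} {v w : α} (hv : v ∈ W) (hw : w ∈ W) (hvw : r v w)
    (hleaf : ∀ x ∈ W, r v x → x = w)
    (ih : ∃ M ρ, IsRankedMatching r {x ∈ W | x ≠ w ∧ ¬ r w x} M ρ) :
    ∃ M ρ, IsRankedMatching r W M ρ := by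
  classical
  obtain ⟨M, ρ, hM⟩ := ih
  have hne : v ≠ w := by rintro rfl; exact hi _ hvw
  have key : ∀ {I J}, M I J → w ∉ I ∧ w ∉ J := fun {I J} h =>
    ⟨fun hI => ((hM.adjacent I J h).1.1 hI).2.1 rfl,
      fun hI => ((hM.adjacent I J h).2.1.1 hI).2.1 rfl⟩
  have inj : ∀ {x : α} {I J : Set α}, x ∉ I → x ∉ J → insert x I = insert x J → I = J := by
    intro x I J h1 h2 h
    rw [← Set.insert_sdiff_self_of_notMem h1, h, Set.insert_sdiff_self_of_notMem h2]
  -- The shift by 2 puts every set containing `w` above the values 0 and 1 of the sets without it,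
  -- so removing `w` lowers the rank. A path never regains `w`: a step from a set without `w` adds
  -- only `v`.
  refine ⟨fun I J => (IndepIn r W J ∧ w ∉ I ∧ v ∉ I ∧ J = insert v I) ∨
      ∃ I₀ J₀, M I₀ J₀ ∧ I = insert w I₀ ∧ J = insert w J₀,
    fun I => if w ∈ I then ρ (I \ {w}) + 2 else if v ∈ I then 0 else 1, ?_, ?_, ?_, ?_⟩
  · rintro I J (⟨hJ, hwI, hvI, rfl⟩ | ⟨I₀, J₀, h, rfl, rfl⟩)
    · exact ⟨hJ.mono (Set.subset_insert _ _), hJ, v, hvI, rfl⟩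
    · obtain ⟨h1, h2⟩ := key h
      obtain ⟨h3, h4, u, hu, rfl⟩ := hM.adjacent _ _ h
      refine ⟨(indepIn_insert hs hi hw h1).2 h3, (indepIn_insert hs hi hw h2).2 h4, u, ?_,
        Set.insert_comm _ _ _⟩
      rintro (rfl | h5)
      · exact h2 (Or.inl rfl)
      · exact hu h5
  · rintro I J I' J' (⟨-, h1, h2, rfl⟩ | ⟨I₀, J₀, h, rfl, rfl⟩)
      (⟨-, h3, h4, rfl⟩ | ⟨I₁, J₁, h', rfl, rfl⟩) hor
    · have h5 : I = I' := by
        rcases hor with h | h | h | h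
        · exact h
        · exact absurd (h ▸ Set.mem_insert _ _) h2
        · exact absurd (h ▸ Set.mem_insert _ _) h4
        · exact inj h2 h4 h
      exact ⟨h5, by rw [h5]⟩
    · exfalso
      have h5 : w ∉ insert v I := by
        rintro (h | h)
        · exact hne h.symm
        · exact h1 h
      rcases hor with h | h | h | h
      · exact h1 (h ▸ Set.mem_insert _ _)
      · exact h1 (h ▸ Set.mem_insert _ _)
      · exact h5 (h ▸ Set.mem_insert _ _)
      · exact h5 (h ▸ Set.mem_insert _ _)
    · exfalso
      have h5 : w ∉ insert v I' := by
        rintro (h | h)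
        · exact hne h.symm
        · exact h3 h
      rcases hor with h | h | h | h
      · exact h3 (h ▸ Set.mem_insert _ _)
      · exact h5 (h ▸ Set.mem_insert _ _)
      · exact h3 (h ▸ Set.mem_insert _ _)
      · exact h5 (h ▸ Set.mem_insert _ _)
    · obtain ⟨h1, h2⟩ := key h
      obtain ⟨h3, h4⟩ := key h'
      obtain ⟨rfl, rfl⟩ := hM.disjoint _ _ _ _ h h' (by
        rcases hor with h | h | h | h
        · exact Or.inl (inj h1 h3 h)
        · exact Or.inr (Or.inl (inj h1 h4 h))
        · exact Or.inr (Or.inr (Or.inl (inj h2 h3 h)))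
        · exact Or.inr (Or.inr (Or.inr (inj h2 h4 h))))
      exact ⟨rfl, rfl⟩
  -- Without `w` the vertex `v` can always be toggled, so an unmatched set contains `w` and comes
  -- from an unmatched set of the smaller matching.
  · have hcrit : ∀ I, IndepIn r W I → IsCritical (fun I J => (IndepIn r W J ∧ w ∉ I ∧ v ∉ I ∧
        J = insert v I) ∨ ∃ I₀ J₀, M I₀ J₀ ∧ I = insert w I₀ ∧ J = insert w J₀) I →
        ∃ I₀, I = insert w I₀ ∧ IndepIn r {x ∈ W | x ≠ w ∧ ¬ r w x} I₀ ∧ IsCritical M I₀ := by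
      intro I hI hc
      by_cases hwI : w ∈ I
      · have hIe : I = insert w (I \ {w}) := by simp [Set.insert_eq_of_mem hwI]
        refine ⟨I \ {w}, hIe, (indepIn_insert hs hi hw (by simp)).1 (hIe ▸ hI), fun d => ⟨?_, ?_⟩⟩
        · exact fun h => (hc (insert w d)).1 (Or.inr ⟨_, _, h, hIe, rfl⟩)
        · exact fun h => (hc (insert w d)).2 (Or.inr ⟨_, _, h, rfl, hIe⟩)
      · exfalso
        by_cases hvI : v ∈ I
        · exact (hc (I \ {v})).2 (Or.inl ⟨hI, fun h => hwI h.1, by simp,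
            by simp [Set.insert_eq_of_mem hvI]⟩)
        · refine (hc (insert v I)).1 (Or.inl ⟨⟨Set.insert_subset hv hI.1, ?_⟩, hwI, hvI, rfl⟩)
          have hvb : ∀ b ∈ I, ¬ r v b := fun b hb h => hwI (hleaf b (hI.1 hb) h ▸ hb)
          rintro a (rfl | ha) b (rfl | hb)
          · exact hi _
          · exact hvb b hb
          · exact fun h => hvb a ha (hs _ _ h)
          · exact hI.2 a ha b hb
    intro I J hI hJ hcI hcJ
    obtain ⟨I₀, rfl, h1, h2⟩ := hcrit I hI hcI
    obtain ⟨J₀, rfl, h3, h4⟩ := hcrit J hJ hcJ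
    rw [hM.unmatched _ _ h1 h3 h2 h4]
  · rintro I J I' u (⟨-, h1, h2, rfl⟩ | ⟨I₀, J₀, h, rfl, rfl⟩) hu hJ hI'
    · have hvI' : v ∈ I' := by
        have h3 : v ∈ insert u I' := hJ ▸ Set.mem_insert _ _
        rcases h3 with rfl | h3
        · exact absurd (inj h2 hu hJ).symm hI'
        · exact h3
      have hwI' : w ∉ I' := by
        intro h
        have h3 : w ∈ insert v I := hJ ▸ Set.mem_insert_of_mem _ h
        rcases h3 with h3 | h3
        · exact hne h3.symm
        · exact h1 h3
      simp [h1, h2, hvI', hwI']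
    · obtain ⟨h1, h2⟩ := key h
      by_cases hwI' : w ∈ I'
      · have hlt : ρ (I' \ {w}) < ρ I₀ := by
          have huw : u ≠ w := fun e => hu (e ▸ hwI')
          refine hM.rank I₀ J₀ _ u h (fun h => hu h.1) ?_ ?_
          · rw [← Set.insert_sdiff_self_of_notMem h2, hJ, Set.insert_sdiff_of_notMem _ (by simpa using huw)]
          · intro e
            apply hI'
            rw [← e]
            simp [Set.insert_eq_of_mem hwI']
        simp [hwI', Set.insert_sdiff_self_of_notMem h1, hlt]
      · simp only [hwI', if_false, Set.mem_insert_iff, true_or, if_true]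
        split_ifs <;> omega

/-- The independent sets of a finite forest have an acyclic matching with at most one unmatched
set; the forest is given by the property that every nonempty set of vertices contains a vertex with
at most one neighbor in the set. -/
theorem exists_isRankedMatching {α : Type*} {r : α → α → Prop} (hs : ∀ a b, r a b → r b a)
    (hi : ∀ a, ¬ r a a)
    (hdeg : ∀ W : Finset α, W.Nonempty → ∃ v ∈ W, ∀ w ∈ W, ∀ w' ∈ W, r v w → r v w' → w = w')
    (W : Finset α) : ∃ M ρ, IsRankedMatching r (W : Set α) M ρ := by
  classical
  induction W using Finset.strongInduction with
  | H W ih =>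
    rcases W.eq_empty_or_nonempty with rfl | hW
    · exact ⟨_, _, by simpa using isRankedMatching_empty r⟩
    · obtain ⟨v, hv, hv'⟩ := hdeg W hW
      by_cases hiso : ∀ w ∈ W, ¬ r v w
      · exact isRankedMatching_isolated hs hi (Finset.mem_coe.2 hv) hiso
      · push Not at hiso
        obtain ⟨w, hw, hvw⟩ := hiso
        refine isRankedMatching_leaf hs hi (Finset.mem_coe.2 hv) (Finset.mem_coe.2 hw) hvw
          (fun x hx h => hv' x hx w hw h hvw) ?_
        have h := ih (W.filter fun x => x ≠ w ∧ ¬ r w x) (Finset.filter_ssubset.2 ⟨w, hw, by simp⟩)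
        simpa using h

/-! ### The structure of apex graphs -/

/-- The sum of the coordinates of an edge midpoint, up to a constant and rounding. -/
def EdgeMidpoint.diagonal (v : EdgeMidpoint) : ℤ := v.1.1 + v.1.2

/-- The difference of the coordinates of an edge midpoint, up to a constant. -/
def EdgeMidpoint.height (v : EdgeMidpoint) : ℤ :=
  match v.2 with
  | Dir.left => v.1.2 - v.1.1 + 1
  | Dir.down => v.1.2 - v.1.1

/-- The parity of `diagonal + height` is odd for left edges and even for lower edges, so the
direction is recovered too. -/
theorem EdgeMidpoint.ext_diagonal_height {v w : EdgeMidpoint} (h₁ : v.diagonal = w.diagonal)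
    (h₂ : v.height = w.height) : v = w := by
  obtain ⟨⟨i, j⟩, _ | _⟩ := v <;> obtain ⟨⟨i', j'⟩, _ | _⟩ := w <;>
    simp only [EdgeMidpoint.diagonal, EdgeMidpoint.height] at h₁ h₂ <;>
    first
    | omega
    | (obtain rfl : i = i' := by omega
       obtain rfl : j = j' := by omega
       rfl)

/-- Adjacency in the apex graph, as a relation on all edge midpoints. -/
def ApexAdj (S : Finset (ℕ × ℕ)) (v w : EdgeMidpoint) : Prop :=
  ApexConflict S v w ∨ ApexConflict S w v

theorem ApexAdj.symm {S : Finset (ℕ × ℕ)} {v w : EdgeMidpoint} (h : ApexAdj S v w) :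
    ApexAdj S w v := Or.symm h

theorem ApexAdj.diagonal_eq {S : Finset (ℕ × ℕ)} {v w : EdgeMidpoint} (h : ApexAdj S v w) :
    v.diagonal = w.diagonal := by
  rcases h with h | h <;> cases h <;> simp [EdgeMidpoint.diagonal] <;> omega

theorem ApexAdj.height_eq {S : Finset (ℕ × ℕ)} {v w : EdgeMidpoint} (h : ApexAdj S v w) :
    w.height = v.height + 1 ∨ v.height = w.height + 1 := by
  rcases h with h | h <;> cases h <;> simp [EdgeMidpoint.height] <;> omega

theorem not_apexAdj_self (S : Finset (ℕ × ℕ)) (v : EdgeMidpoint) : ¬ ApexAdj S v v := by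
  intro h
  have := h.height_eq
  omega

theorem apexGraph_adj {S : Finset (ℕ × ℕ)} {v w : apexVertices S} :
    (apexGraph S).Adj v w ↔ ApexAdj S v.1 w.1 := by
  rw [apexGraph, SimpleGraph.fromRel_adj]
  refine ⟨fun h => h.2, fun h => ⟨?_, h⟩⟩
  rintro rfl
  exact not_apexAdj_self S _ h

theorem finite_apexVertices (S : Finset (ℕ × ℕ)) : (apexVertices S).Finite := by
  have h : (Set.univ : Set Dir).Finite := (Set.toFinite {Dir.left, Dir.down}).subset
    fun d _ => by cases d <;> simp
  refine (S.finite_toSet.prod h).subset fun v hv => ⟨hv.1, trivial⟩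

theorem mem_apexIndepSets {S : Finset (ℕ × ℕ)} {I : Set EdgeMidpoint} :
    I ∈ apexIndepSets S ↔ IndepIn (ApexAdj S) (apexVertices S) I := by
  constructor
  · rintro ⟨J, hJ, rfl⟩
    refine ⟨by rintro _ ⟨v, -, rfl⟩; exact v.2, ?_⟩
    rintro _ ⟨v, hv, rfl⟩ _ ⟨w, hw, rfl⟩ h
    have h' := apexGraph_adj.2 h
    exact hJ hv hw h'.ne h'
  · rintro ⟨h₁, h₂⟩
    refine ⟨Subtype.val ⁻¹' I, fun v hv w hw _ h => h₂ _ hv _ hw (apexGraph_adj.1 h), ?_⟩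
    rw [Subtype.image_preimage_coe, Set.inter_eq_right.2 h₁]

/-- From a vertex of minimal height, a neighbor can only be one step higher on the same
antidiagonal, which leaves a single candidate. -/
theorem exists_apexAdj_leaf (S : Finset (ℕ × ℕ)) (W : Finset EdgeMidpoint) (hW : W.Nonempty) :
    ∃ v ∈ W, ∀ w ∈ W, ∀ w' ∈ W, ApexAdj S v w → ApexAdj S v w' → w = w' := by
  obtain ⟨v, hv, hmin⟩ := W.exists_min_image EdgeMidpoint.height hW
  refine ⟨v, hv, fun w hw w' hw' h h' => EdgeMidpoint.ext_diagonal_height ?_ ?_⟩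
  · rw [← h.diagonal_eq, h'.diagonal_eq]
  · have h1 := hmin w hw
    have h2 := hmin w' hw'
    have h3 := h.height_eq
    have h4 := h'.height_eq
    omega

theorem isDisjointUnionOfPaths_apexGraph (S : Finset (ℕ × ℕ)) :
    IsDisjointUnionOfPaths (apexGraph S) := by
  intro c
  have : Finite (apexVertices S) := finite_apexVertices S
  have hdiag : ∀ v w, (apexGraph S).Reachable v w → v.1.diagonal = w.1.diagonal := by
    rintro v w ⟨p⟩
    induction p with
    | nil => rfl
    | cons h _ ih => exact (apexGraph_adj.1 h).diagonal_eq.trans ih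
  refine nonempty_iso_pathGraph c.connected_toSimpleGraph.preconnected
    (fun v => v.1.1.height) ?_ fun v w h => (apexGraph_adj.1 h).height_eq
  intro v w h
  exact Subtype.ext (Subtype.ext (EdgeMidpoint.ext_diagonal_height
    (hdiag _ _ (SimpleGraph.ConnectedComponent.exact (v.2.trans w.2.symm))) h))

theorem exists_apexMatching (S : Finset (ℕ × ℕ)) :
    ∃ M ρ, IsRankedMatching (ApexAdj S) (apexVertices S) M ρ := by
  have h := exists_isRankedMatching (r := ApexAdj S) (fun _ _ => ApexAdj.symm) (not_apexAdj_self S)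
    (exists_apexAdj_leaf S) (finite_apexVertices S).toFinset
  rwa [Set.Finite.coe_toFinset] at h

theorem IsRankedMatching.isIndepSetMatching {S : Finset (ℕ × ℕ)}
    {M : Set EdgeMidpoint → Set EdgeMidpoint → Prop} {ρ : Set EdgeMidpoint → ℕ}
    (h : IsRankedMatching (ApexAdj S) (apexVertices S) M ρ) : IsIndepSetMatching S M where
  adjacent I J hIJ := by
    rw [mem_apexIndepSets, mem_apexIndepSets]
    exact h.adjacent I J hIJ
  disjoint := h.disjoint
  unmatched I hI J hJ := h.unmatched I J (mem_apexIndepSets.1 hI) (mem_apexIndepSets.1 hJ)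

/-! ### Cells as arrangements of disjoint rectangles -/

theorem GridInterval.left_le_right {m : ℕ} (I : GridInterval m) : I.left ≤ I.right := by
  rcases I.right_eq with h | h <;> omega

theorem GridInterval.left_mem {m : ℕ} (I : GridInterval m) :
    (I.left : ℝ) ∈ Set.Icc (I.left : ℝ) (I.right : ℝ) :=
  ⟨le_rfl, Nat.cast_le.2 I.left_le_right⟩

theorem GridInterval.right_mem {m : ℕ} (I : GridInterval m) :
    (I.right : ℝ) ∈ Set.Icc (I.left : ℝ) (I.right : ℝ) :=
  ⟨Nat.cast_le.2 I.left_le_right, le_rfl⟩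

/-- Two rectangles of board squares are disjoint. -/
def RectDisjoint {p q : ℕ} (R R' : GridInterval p × GridInterval q) : Prop :=
  (R.1.right < R'.1.left ∨ R'.1.right < R.1.left) ∨ (R.2.right < R'.2.left ∨ R'.2.right < R.2.left)

theorem RectDisjoint.symm {p q : ℕ} {R R' : GridInterval p × GridInterval q}
    (h : RectDisjoint R R') : RectDisjoint R' R :=
  Or.imp Or.symm Or.symm h

/-- Overlapping grid intervals have a common point. -/
theorem GridInterval.separated {m : ℕ} {I J : GridInterval m}
    (h : ∀ t ∈ Set.Icc (I.left : ℝ) (I.right : ℝ), t ∉ Set.Icc (J.left : ℝ) (J.right : ℝ)) :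
    I.right < J.left ∨ J.right < I.left := by
  by_contra! hc
  have h₁ : ((max I.left J.left : ℕ) : ℝ) ∈ Set.Icc (I.left : ℝ) (I.right : ℝ) :=
    ⟨Nat.cast_le.2 (le_max_left _ _), Nat.cast_le.2 (max_le I.left_le_right hc.1)⟩
  exact h _ h₁ ⟨Nat.cast_le.2 (le_max_right _ _), Nat.cast_le.2 (max_le hc.2 J.left_le_right)⟩

theorem GridInterval.one_le_abs_sub {m : ℕ} {I J : GridInterval m} {s t : ℝ}
    (hs : s ∈ Set.Icc (I.left : ℝ) (I.right : ℝ)) (ht : t ∈ Set.Icc (J.left : ℝ) (J.right : ℝ))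
    (h : I.right < J.left ∨ J.right < I.left) : 1 ≤ |s - t| := by
  rcases h with h | h
  · have h' : (I.right : ℝ) + 1 ≤ J.left := by exact_mod_cast h
    rw [abs_sub_comm]
    exact le_trans (by linarith [hs.2, ht.1]) (le_abs_self _)
  · have h' : (J.right : ℝ) + 1 ≤ I.left := by exact_mod_cast h
    exact le_trans (by linarith [hs.1, ht.2]) (le_abs_self _)

theorem closedCell_subset_configSpace {n p q : ℕ} {σ : AmbientCell n p q} :
    σ.closedCell ⊆ configSpace n p q ↔ ∀ k l, k ≠ l → RectDisjoint (σ k) (σ l) := by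
  constructor
  · intro h
    have hlt : ∀ k l, k < l → RectDisjoint (σ k) (σ l) := by
      intro k l hkl
      by_contra hc
      rw [RectDisjoint, not_or] at hc
      obtain ⟨s, hs, hs'⟩ : ∃ s ∈ Set.Icc ((σ k).1.left : ℝ) ((σ k).1.right : ℝ),
          s ∈ Set.Icc ((σ l).1.left : ℝ) ((σ l).1.right : ℝ) := by
        by_contra! h'
        exact hc.1 (GridInterval.separated h')
      obtain ⟨t, ht, ht'⟩ : ∃ s ∈ Set.Icc ((σ k).2.left : ℝ) ((σ k).2.right : ℝ),
          s ∈ Set.Icc ((σ l).2.left : ℝ) ((σ l).2.right : ℝ) := by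
        by_contra! h'
        exact hc.2 (GridInterval.separated h')
      -- Overlapping pieces `k` and `l` may both be centered at a common point `(s, t)`, which
      -- violates the distance condition; the other pieces sit anywhere in their ranges.
      have hz : (fun i => if i = k ∨ i = l then (s, t) else
          (((σ i).1.left : ℝ), ((σ i).2.left : ℝ))) ∈ configSpace n p q := by
        apply h
        intro i
        by_cases hi : i = k ∨ i = l
        · simp only [hi, if_true]
          rcases hi with rfl | rfl
          · exact ⟨hs, ht⟩
          · exact ⟨hs', ht'⟩
        · simp only [hi, if_false]
          exact ⟨GridInterval.left_mem _, GridInterval.left_mem _⟩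
      have := hz.2 k l hkl
      norm_num at this
    intro k l hkl
    rcases lt_or_gt_of_ne hkl with h' | h'
    · exact hlt k l h'
    · exact (hlt l k h').symm
  · intro h z hz
    refine ⟨fun k => ⟨⟨?_, ?_⟩, ?_, ?_⟩, fun k l hkl => ?_⟩
    · exact le_trans (by exact_mod_cast (σ k).1.one_le_left) (hz k).1.1
    · exact (hz k).1.2.trans (by exact_mod_cast (σ k).1.right_le)
    · exact le_trans (by exact_mod_cast (σ k).2.one_le_left) (hz k).2.1
    · exact (hz k).2.2.trans (by exact_mod_cast (σ k).2.right_le)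
    · exact (h k l hkl.ne).imp (GridInterval.one_le_abs_sub (hz k).1 (hz l).1)
        (GridInterval.one_le_abs_sub (hz k).2 (hz l).2)

namespace Cell

variable {n p q : ℕ}

theorem rectDisjoint (e : Cell n p q) {k l : Fin n} (h : k ≠ l) : RectDisjoint (e.1 k) (e.1 l) :=
  closedCell_subset_configSpace.1 e.2 k l h

theorem pos_injective (e : Cell n p q) : Function.Injective e.pos := by
  intro k l h
  by_contra hkl
  have h₁ := e.rectDisjoint hkl
  have h₂ := congrArg Prod.fst h
  have h₃ := congrArg Prod.snd h
  have := (e.1 k).1.left_le_right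
  have := (e.1 k).2.left_le_right
  have := (e.1 l).1.left_le_right
  have := (e.1 l).2.left_le_right
  simp only [pos] at h₂ h₃
  unfold RectDisjoint at h₁
  omega

theorem isFace_iff {f e : Cell n p q} : f.IsFace e ↔ ∀ k,
    ((e.1 k).1.left ≤ (f.1 k).1.left ∧ (f.1 k).1.right ≤ (e.1 k).1.right) ∧
    ((e.1 k).2.left ≤ (f.1 k).2.left ∧ (f.1 k).2.right ≤ (e.1 k).2.right) := by
  constructor
  · intro h k
    have h₁ : (fun k => (((f.1 k).1.left : ℝ), ((f.1 k).2.left : ℝ))) ∈ e.1.closedCell :=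
      h fun k => ⟨GridInterval.left_mem _, GridInterval.left_mem _⟩
    have h₂ : (fun k => (((f.1 k).1.right : ℝ), ((f.1 k).2.right : ℝ))) ∈ e.1.closedCell :=
      h fun k => ⟨GridInterval.right_mem _, GridInterval.right_mem _⟩
    exact ⟨⟨Nat.cast_le.1 (h₁ k).1.1, Nat.cast_le.1 (h₂ k).1.2⟩,
      Nat.cast_le.1 (h₁ k).2.1, Nat.cast_le.1 (h₂ k).2.2⟩
  · intro h z hz k
    exact ⟨Set.Icc_subset_Icc (Nat.cast_le.2 (h k).1.1) (Nat.cast_le.2 (h k).1.2) (hz k).1,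
      Set.Icc_subset_Icc (Nat.cast_le.2 (h k).2.1) (Nat.cast_le.2 (h k).2.2) (hz k).2⟩

theorem ext_left_right {f e : Cell n p q}
    (h₁ : ∀ k, (f.1 k).1.left = (e.1 k).1.left ∧ (f.1 k).2.left = (e.1 k).2.left)
    (h₂ : ∀ k, (f.1 k).1.right = (e.1 k).1.right ∧ (f.1 k).2.right = (e.1 k).2.right) : f = e :=
  Subtype.ext (funext fun k => Prod.ext (GridInterval.ext (h₁ k).1 (h₂ k).1)
    (GridInterval.ext (h₁ k).2 (h₂ k).2))

theorem apex_eq_apex_iff {f e : Cell n p q} : f.apex = e.apex ↔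
    ∀ k, (f.1 k).1.right = (e.1 k).1.right ∧ (f.1 k).2.right = (e.1 k).2.right := by
  constructor
  · intro h k
    have h' : f.apex.1 k = e.apex.1 k := by rw [h]
    exact ⟨congrArg (fun R => R.1.right) h', congrArg (fun R => R.2.right) h'⟩
  · intro h
    exact ext_left_right h h

theorem pos_apex (e : Cell n p q) : e.apex.pos = e.pos := rfl

theorem occupied_apex (e : Cell n p q) : e.apex.occupied = e.occupied := rfl

theorem pos_eq_of_apex_eq {f e : Cell n p q} (h : f.apex = e.apex) : f.pos = e.pos := by
  rw [← pos_apex f, h, pos_apex]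

theorem occupied_eq_of_apex_eq {f e : Cell n p q} (h : f.apex = e.apex) :
    f.occupied = e.occupied := by
  rw [← occupied_apex f, h, occupied_apex]

theorem pos_mem_occupied (e : Cell n p q) (k : Fin n) : e.pos k ∈ e.occupied :=
  Finset.mem_image_of_mem _ (Finset.mem_univ k)

theorem mem_occupied {e : Cell n p q} {s : ℕ × ℕ} : s ∈ e.occupied ↔ ∃ k, e.pos k = s := by
  simp [occupied]

theorem mem_extensions_left {e : Cell n p q} {k : Fin n} :
    (e.pos k, Dir.left) ∈ e.extensions ↔ (e.1 k).1.right = (e.1 k).1.left + 1 := by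
  constructor
  · rintro ⟨l, hl, h⟩
    obtain rfl := e.pos_injective hl
    exact h
  · exact fun h => ⟨k, rfl, h⟩

theorem mem_extensions_down {e : Cell n p q} {k : Fin n} :
    (e.pos k, Dir.down) ∈ e.extensions ↔ (e.1 k).2.right = (e.1 k).2.left + 1 := by
  constructor
  · rintro ⟨l, hl, h⟩
    obtain rfl := e.pos_injective hl
    exact h
  · exact fun h => ⟨k, rfl, h⟩

/-- The right endpoints agree, so containment compares only left endpoints, each of which is one of
two values decided by an extension. -/
theorem isFace_iff_extensions_subset {f e : Cell n p q} (h : f.apex = e.apex) :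
    f.IsFace e ↔ f.extensions ⊆ e.extensions := by
  have hpos := pos_eq_of_apex_eq h
  rw [apex_eq_apex_iff] at h
  rw [isFace_iff]
  constructor
  · rintro hf ⟨s, _ | _⟩ ⟨k, rfl, hk⟩
    · rw [hpos, mem_extensions_left]
      have := hf k
      have := h k
      have := (e.1 k).1.right_eq
      simp only at hk
      omega
    · rw [hpos, mem_extensions_down]
      have := hf k
      have := h k
      have := (e.1 k).2.right_eq
      simp only at hk
      omega
  · intro hsub k
    have h₁ := @hsub (f.pos k, Dir.left)
    have h₂ := @hsub (f.pos k, Dir.down)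
    rw [mem_extensions_left, hpos, mem_extensions_left] at h₁
    rw [mem_extensions_down, hpos, mem_extensions_down] at h₂
    have := h k
    have := (e.1 k).1.right_eq
    have := (e.1 k).2.right_eq
    have := (f.1 k).1.right_eq
    have := (f.1 k).2.right_eq
    omega

theorem eq_of_extensions_eq {f e : Cell n p q} (h : f.apex = e.apex)
    (h' : f.extensions = e.extensions) : f = e := by
  have h₁ := isFace_iff.1 ((isFace_iff_extensions_subset h).2 h'.subset)
  have h₂ := isFace_iff.1 ((isFace_iff_extensions_subset h.symm).2 h'.superset)
  exact ext_left_right (fun k => ⟨le_antisymm (h₂ k).1.1 (h₁ k).1.1,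
    le_antisymm (h₂ k).2.1 (h₁ k).2.1⟩) (apex_eq_apex_iff.1 h)

theorem extensions_eq (e : Cell n p q) : e.extensions =
    (fun k => (e.pos k, Dir.left)) '' {k | (e.1 k).1.right = (e.1 k).1.left + 1} ∪
    (fun k => (e.pos k, Dir.down)) '' {k | (e.1 k).2.right = (e.1 k).2.left + 1} := by
  ext ⟨s, d⟩
  cases d <;> simp [extensions, and_comm]

theorem finite_extensions (e : Cell n p q) : e.extensions.Finite := by
  rw [extensions_eq]
  exact ((Set.toFinite _).image _).union ((Set.toFinite _).image _)

theorem dim_eq_ncard_extensions (e : Cell n p q) : e.dim = e.extensions.ncard := by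
  classical
  have hinj : ∀ d : Dir, Function.Injective fun k => (e.pos k, d) := fun d k l h =>
    e.pos_injective (congrArg Prod.fst h)
  rw [extensions_eq, Set.ncard_union_eq _ ((Set.toFinite _).image _) ((Set.toFinite _).image _),
    Set.ncard_image_of_injective _ (hinj _), Set.ncard_image_of_injective _ (hinj _), dim,
    Finset.sum_add_distrib]
  · congr 1
    · rw [Set.ncard_eq_toFinset_card', Set.toFinset_ofPred, Finset.card_filter]
      refine Finset.sum_congr rfl fun k _ => ?_
      have := (e.1 k).1.right_eq
      split_ifs <;> omega
    · rw [Set.ncard_eq_toFinset_card', Set.toFinset_ofPred, Finset.card_filter]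
      refine Finset.sum_congr rfl fun k _ => ?_
      have := (e.1 k).2.right_eq
      split_ifs <;> omega
  · rw [Set.disjoint_left]
    rintro _ ⟨k, -, rfl⟩ ⟨l, -, h⟩
    simp at h

theorem isFacet_iff_exists_insert {f e : Cell n p q} (h : f.apex = e.apex) :
    IsFacet IsFace dim f e ↔ ∃ v, v ∉ f.extensions ∧ e.extensions = insert v f.extensions := by
  rw [IsFacet, isFace_iff_extensions_subset h, dim_eq_ncard_extensions, dim_eq_ncard_extensions]
  constructor
  · rintro ⟨hsub, hcard⟩
    have h₁ : (e.extensions \ f.extensions).ncard = 1 := by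
      rw [Set.ncard_sdiff hsub f.finite_extensions]
      omega
    obtain ⟨v, hv⟩ := Set.ncard_eq_one.1 h₁
    have hv' : v ∈ e.extensions \ f.extensions := by simp [hv]
    refine ⟨v, hv'.2, ?_⟩
    rw [Set.insert_eq, ← hv, Set.sdiff_union_of_subset hsub]
  · rintro ⟨v, hv, he⟩
    rw [he]
    exact ⟨Set.subset_insert _ _, Set.ncard_insert_of_notMem hv f.finite_extensions⟩

/-! ### Cells with a given apex and independent sets -/

/-- Each failure makes two pieces share a square. An extension into an occupied location hits the
piece there. A `same` conflict is a 2 by 2 piece covering the occupied square at its lower left. In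
a `diag` conflict both pieces cover `(i, j)`. -/
theorem extensions_mem_apexIndepSets (e : Cell n p q) :
    e.extensions ∈ apexIndepSets e.occupied := by
  rw [mem_apexIndepSets]
  have hoc : ∀ {k l : Fin n}, k ≠ l → RectDisjoint (e.1 k) (e.1 l) := fun h => e.rectDisjoint h
  have hconf : ∀ v ∈ e.extensions, ∀ w ∈ e.extensions, ¬ ApexConflict e.occupied v w := by
    rintro v ⟨k, hk, hk'⟩ w ⟨l, hl, hl'⟩ (⟨i, j, hij⟩ | ⟨i, j⟩)
    · simp only [pos, Prod.mk.injEq] at hk hl hk' hl'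
      obtain ⟨m, hm⟩ := mem_occupied.1 hij
      obtain rfl : k = l := e.pos_injective (Prod.ext (by simp [pos]; omega) (by simp [pos]; omega))
      simp only [pos, Prod.mk.injEq] at hm
      have hmk : m ≠ k := by rintro rfl; omega
      have := hoc hmk
      have := (e.1 m).1.left_le_right
      have := (e.1 m).2.left_le_right
      unfold RectDisjoint at *
      omega
    · simp only [pos, Prod.mk.injEq] at hk hl hk' hl'
      have := (e.1 k).2.left_le_right
      have := (e.1 l).1.left_le_right
      have hlk : l ≠ k := by rintro rfl; omega
      have := hoc hlk
      unfold RectDisjoint at *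
      omega
  refine ⟨?_, fun v hv w hw h => h.elim (hconf v hv w hw) (hconf w hw v hv)⟩
  rintro ⟨⟨i, j⟩, d⟩ ⟨k, hk, hk'⟩
  refine ⟨mem_occupied.2 ⟨k, hk⟩, ?_⟩
  cases d <;> simp only [pos, Prod.mk.injEq] at hk hk' ⊢
  · have := (e.1 k).1.one_le_left
    refine ⟨by omega, fun hS => ?_⟩
    obtain ⟨m, hm⟩ := mem_occupied.1 hS
    simp only [pos, Prod.mk.injEq] at hm
    have hmk : m ≠ k := by rintro rfl; omega
    have := hoc hmk
    have := (e.1 m).1.left_le_right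
    have := (e.1 m).2.left_le_right
    have := (e.1 k).2.left_le_right
    unfold RectDisjoint at *
    omega
  · have := (e.1 k).2.one_le_left
    refine ⟨by omega, fun hS => ?_⟩
    obtain ⟨m, hm⟩ := mem_occupied.1 hS
    simp only [pos, Prod.mk.injEq] at hm
    have hmk : m ≠ k := by rintro rfl; omega
    have := hoc hmk
    have := (e.1 m).1.left_le_right
    have := (e.1 m).2.left_le_right
    have := (e.1 k).1.left_le_right
    unfold RectDisjoint at *
    omega

end Cell

/-- The grid interval with the same right endpoint as `I`, of length one if `P` holds and there is
room for it. -/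
def GridInterval.extend {m : ℕ} (I : GridInterval m) (P : Prop) [Decidable P] : GridInterval m where
  left := if P ∧ 1 < I.right then I.right - 1 else I.right
  right := I.right
  one_le_left := by
    have := I.one_le_left
    have := I.left_le_right
    split_ifs <;> omega
  right_le := I.right_le
  right_eq := by split_ifs <;> omega

namespace Cell

variable {n p q : ℕ}

theorem apex_eq_self {a : Cell n p q} (h : a.dim = 0) : a.apex = a := by
  have h' : ∀ k, (a.1 k).1.right - (a.1 k).1.left + ((a.1 k).2.right - (a.1 k).2.left) = 0 := by
    simpa only [dim, Finset.sum_eq_zero_iff, Finset.mem_univ, true_imp_iff] using h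
  refine ext_left_right (fun k => ?_) (fun k => ⟨rfl, rfl⟩)
  have := h' k
  have := (a.1 k).1.left_le_right
  have := (a.1 k).2.left_le_right
  change (a.1 k).1.right = _ ∧ (a.1 k).2.right = _
  omega

/-- If two extended pieces overlap, either one contains the other's upper-right corner, which the
vertex conditions and `same` edges forbid, or one corner is to the right of and below the other.
Then the right piece extends left and the upper one down onto a common square, which is a `diag`
edge. -/
theorem exists_cell_of_indepIn (a : Cell n p q) {I : Set EdgeMidpoint}
    (hI : I ∈ apexIndepSets a.occupied) : ∃ e : Cell n p q, e.apex = a.apex ∧ e.extensions = I := by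
  classical
  obtain ⟨hsub, hind⟩ := mem_apexIndepSets.1 hI
  have hL : ∀ k, (a.pos k, Dir.left) ∈ I → 1 < (a.1 k).1.right ∧ ∀ l,
      ¬ ((a.1 l).1.right + 1 = (a.1 k).1.right ∧ (a.1 l).2.right = (a.1 k).2.right) := by
    intro k hk
    obtain ⟨-, h₁, h₂⟩ := hsub hk
    refine ⟨h₁, fun l hl => h₂ (mem_occupied.2 ⟨l, ?_⟩)⟩
    exact Prod.ext (by simp only [pos]; omega) hl.2
  have hD : ∀ k, (a.pos k, Dir.down) ∈ I → 1 < (a.1 k).2.right ∧ ∀ l,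
      ¬ ((a.1 l).1.right = (a.1 k).1.right ∧ (a.1 l).2.right + 1 = (a.1 k).2.right) := by
    intro k hk
    obtain ⟨-, h₁, h₂⟩ := hsub hk
    refine ⟨h₁, fun l hl => h₂ (mem_occupied.2 ⟨l, ?_⟩)⟩
    exact Prod.ext hl.1 (by simp only [pos]; omega)
  have hLD : ∀ k, (a.pos k, Dir.left) ∈ I → (a.pos k, Dir.down) ∈ I → ∀ l,
      ¬ ((a.1 l).1.right + 1 = (a.1 k).1.right ∧ (a.1 l).2.right + 1 = (a.1 k).2.right) := by
    intro k hk hk' l hl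
    refine hind _ hk _ hk' (Or.inl ?_)
    have h := ApexConflict.same (S := a.occupied) _ _ (a.pos_mem_occupied l)
    have hpos : a.pos k = ((a.pos l).1 + 1, (a.pos l).2 + 1) := Prod.ext hl.1.symm hl.2.symm
    rwa [hpos]
  have hdiag : ∀ k l, (a.pos k, Dir.left) ∈ I → (a.pos l, Dir.down) ∈ I →
      ¬ ((a.1 l).1.right + 1 = (a.1 k).1.right ∧ (a.1 k).2.right + 1 = (a.1 l).2.right) := by
    intro k l hk hl h
    refine hind _ hk _ hl (Or.inl ?_)
    have h' := ApexConflict.diag (S := a.occupied) (a.pos l).1 (a.pos k).2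
    have hpos : a.pos k = ((a.pos l).1 + 1, (a.pos k).2) := Prod.ext h.1.symm rfl
    have hpos' : a.pos l = ((a.pos l).1, (a.pos k).2 + 1) := Prod.ext rfl h.2.symm
    rwa [← hpos, ← hpos'] at h'
  have hdisj : ∀ k l, k ≠ l → RectDisjoint
      ((a.1 k).1.extend ((a.pos k, Dir.left) ∈ I), (a.1 k).2.extend ((a.pos k, Dir.down) ∈ I))
      ((a.1 l).1.extend ((a.pos l, Dir.left) ∈ I), (a.1 l).2.extend ((a.pos l, Dir.down) ∈ I)) := by
    intro k l hkl
    have hne : ¬ ((a.1 k).1.right = (a.1 l).1.right ∧ (a.1 k).2.right = (a.1 l).2.right) :=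
      fun h => hkl (a.pos_injective (Prod.ext h.1 h.2))
    have hkl₁ := hdiag k l
    have hkl₂ := hdiag l k
    have hLk := fun h => (hL k h).2 l
    have hLl := fun h => (hL l h).2 k
    have hDk := fun h => (hD k h).2 l
    have hDl := fun h => (hD l h).2 k
    have hk := fun h h' => hLD k h h' l
    have hl := fun h h' => hLD l h h' k
    simp only [RectDisjoint, GridInterval.extend]
    clear hdiag hL hD hLD hsub hind
    by_cases h₁ : (a.pos k, Dir.left) ∈ I <;> by_cases h₂ : (a.pos k, Dir.down) ∈ I <;>
      by_cases h₃ : (a.pos l, Dir.left) ∈ I <;> by_cases h₄ : (a.pos l, Dir.down) ∈ I <;>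
      simp only [h₁, h₂, h₃, h₄, true_imp_iff, false_imp_iff, true_and, false_and, if_false]
        at hkl₁ hkl₂ hLk hLl hDk hDl hk hl ⊢ <;>
      (try split_ifs) <;> omega
  let e : Cell n p q := ⟨fun k => ((a.1 k).1.extend ((a.pos k, Dir.left) ∈ I),
    (a.1 k).2.extend ((a.pos k, Dir.down) ∈ I)), closedCell_subset_configSpace.2 hdisj⟩
  have hae : e.apex = a.apex := apex_eq_apex_iff.2 fun k => ⟨rfl, rfl⟩
  have hpos : e.pos = a.pos := pos_eq_of_apex_eq hae
  refine ⟨e, hae, Set.ext ?_⟩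
  rintro ⟨s, d⟩
  have hs : ∀ {J : Set EdgeMidpoint}, J ⊆ apexVertices a.occupied → (s, d) ∈ J →
      ∃ k, a.pos k = s := fun hJ h => mem_occupied.1 (hJ h).1
  by_cases hk : ∃ k, a.pos k = s
  · obtain ⟨k, rfl⟩ := hk
    cases d
    · rw [← hpos, mem_extensions_left, hpos]
      change (a.1 k).1.right = (if _ then _ else _) + 1 ↔ _
      by_cases h : (a.pos k, Dir.left) ∈ I
      -- A vertex of the apex graph has room on the board, so the guard in `extend` never suppresses
      -- an extension demanded by `I`.
      · have := (hL k h).1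
        rw [if_pos ⟨h, this⟩, Nat.sub_add_cancel this.le]
        exact iff_of_true rfl h
      · simp [h]
    · rw [← hpos, mem_extensions_down, hpos]
      change (a.1 k).2.right = (if _ then _ else _) + 1 ↔ _
      by_cases h : (a.pos k, Dir.down) ∈ I
      · have := (hD k h).1
        rw [if_pos ⟨h, this⟩, Nat.sub_add_cancel this.le]
        exact iff_of_true rfl h
      · simp [h]
  · refine ⟨fun h => absurd ?_ hk, fun h => absurd (hs hsub h) hk⟩
    obtain ⟨k, hk, -⟩ := h
    exact ⟨k, hpos ▸ hk⟩

theorem bijOn_extensions {a : Cell n p q} (ha : a.dim = 0) :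
    Set.BijOn extensions {e | e.apex = a} (apexIndepSets a.occupied) := by
  refine ⟨fun e he => ?_, fun f hf e he h => eq_of_extensions_eq (hf.trans he.symm) h,
    fun I hI => ?_⟩
  · rw [← (he : e.apex = a), occupied_apex]
    exact e.extensions_mem_apexIndepSets
  · obtain ⟨e, he, rfl⟩ := exists_cell_of_indepIn a hI
    exact ⟨e, he.trans (apex_eq_self ha), rfl⟩

/-! ### Relabeling -/

theorem occupied_relabel (π : Equiv.Perm (Fin n)) (e : Cell n p q) :
    (e.relabel π).occupied = e.occupied := by
  ext s
  rw [mem_occupied, mem_occupied]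
  exact π.symm.surjective.exists (p := fun k => e.pos k = s) |>.symm

theorem extensions_relabel (π : Equiv.Perm (Fin n)) (e : Cell n p q) :
    (e.relabel π).extensions = e.extensions := by
  ext ⟨s, _ | _⟩
  · exact π.symm.surjective.exists (p := fun k => e.pos k = s ∧
      (e.1 k).1.right = (e.1 k).1.left + 1) |>.symm
  · exact π.symm.surjective.exists (p := fun k => e.pos k = s ∧
      (e.1 k).2.right = (e.1 k).2.left + 1) |>.symm

theorem apex_relabel (π : Equiv.Perm (Fin n)) (e : Cell n p q) :
    (e.relabel π).apex = e.apex.relabel π := rfl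

/-! ### The gradient vector field -/

/-- The pairs of cells with the same apex whose independent sets are matched. -/
def MatchedBy (M : Finset (ℕ × ℕ) → Set EdgeMidpoint → Set EdgeMidpoint → Prop)
    (f e : Cell n p q) : Prop :=
  f.apex = e.apex ∧ M f.occupied f.extensions e.extensions

/-- The sum of the coordinates of the apex. -/
def apexSum (e : Cell n p q) : ℕ := ∑ k, ((e.1 k).1.right + (e.1 k).2.right)

theorem apexSum_eq_of_apex_eq {f e : Cell n p q} (h : f.apex = e.apex) : f.apexSum = e.apexSum :=
  Finset.sum_congr rfl fun k _ => by rw [(apex_eq_apex_iff.1 h k).1, (apex_eq_apex_iff.1 h k).2]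

/-- Passing to a face can only lower right endpoints. -/
theorem IsFace.apexSum_lt {f e : Cell n p q} (h : f.IsFace e) (h' : f.apex ≠ e.apex) :
    f.apexSum < e.apexSum := by
  rw [isFace_iff] at h
  rw [Ne, apex_eq_apex_iff] at h'
  push Not at h'
  obtain ⟨k, hk⟩ := h'
  refine Finset.sum_lt_sum (fun l _ => add_le_add (h l).1.2 (h l).2.2) ⟨k, Finset.mem_univ k, ?_⟩
  have := h k
  omega

variable {M : Finset (ℕ × ℕ) → Set EdgeMidpoint → Set EdgeMidpoint → Prop}
  {ρ : Finset (ℕ × ℕ) → Set EdgeMidpoint → ℕ}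

theorem isDiscreteGradient_matchedBy
    (hM : ∀ S, IsRankedMatching (ApexAdj S) (apexVertices S) (M S) (ρ S)) :
    IsDiscreteGradient (K := Cell n p q) IsFace dim (MatchedBy M) where
  facet f e h := (isFacet_iff_exists_insert h.1).2 ((hM _).adjacent _ _ h.2).2.2
  disjoint := by
    rintro f e f' e' ⟨h₁, h₂⟩ ⟨h₃, h₄⟩ h
    -- Pairs never mix apexes, so a shared cell puts all four cells at one apex and the matching
    -- there decides.
    have hff : f.apex = f'.apex := by
      rcases h with rfl | rfl | rfl | rfl
      · rfl
      · exact h₃.symm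
      · exact h₁
      · exact h₁.trans h₃.symm
    rw [← occupied_eq_of_apex_eq hff] at h₄
    obtain ⟨h₅, h₆⟩ := (hM _).disjoint _ _ _ _ h₂ h₄ (by
      rcases h with rfl | rfl | rfl | rfl <;> simp)
    exact ⟨eq_of_extensions_eq hff h₅, eq_of_extensions_eq (h₁.symm.trans (hff.trans h₃)) h₆⟩
  acyclic := by
    have hstep : ∀ f f' : Cell n p q, VStep IsFace dim (MatchedBy M) f f' →
        toLex (f'.apexSum, ρ f'.occupied f'.extensions) <
          toLex (f.apexSum, ρ f.occupied f.extensions) := by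
      rintro f f' ⟨e, ⟨hfe, hm⟩, hf', hne⟩
      rw [Prod.Lex.toLex_lt_toLex]
      by_cases h : f'.apex = e.apex
      · obtain ⟨u, hu, he⟩ := (isFacet_iff_exists_insert h).1 hf'
        have hff : f'.apex = f.apex := h.trans hfe.symm
        refine Or.inr ⟨apexSum_eq_of_apex_eq hff, ?_⟩
        rw [occupied_eq_of_apex_eq hff]
        exact (hM _).rank _ _ _ u hm hu he fun h' => hne (eq_of_extensions_eq hff h')
      · refine Or.inl ?_
        rw [apexSum_eq_of_apex_eq hfe]
        exact hf'.1.apexSum_lt h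
    intro f hf
    have hlt : ∀ g, Relation.TransGen (VStep IsFace dim (MatchedBy M)) f g →
        toLex (g.apexSum, ρ g.occupied g.extensions) <
          toLex (f.apexSum, ρ f.occupied f.extensions) := by
      intro g hg
      induction hg with
      | single h => exact hstep _ _ h
      | tail _ h ih => exact (hstep _ _ h).trans ih
    exact lt_irrefl _ (hlt f hf)

/-- A partner of the independent set would be realized by a cell with the same apex, which would be
a partner of `c`. -/
theorem isCritical_extensions {c : Cell n p q} (hM : ∀ S, IsIndepSetMatching S (M S))
    (h : IsCritical (MatchedBy M) c) : IsCritical (M c.occupied) c.extensions := by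
  refine fun J => ⟨fun hJ => ?_, fun hJ => ?_⟩
  · obtain ⟨d, hd, rfl⟩ := c.exists_cell_of_indepIn ((hM _).adjacent _ _ hJ).2.1
    exact (h d).1 ⟨hd.symm, hJ⟩
  · obtain ⟨d, hd, rfl⟩ := c.exists_cell_of_indepIn ((hM _).adjacent _ _ hJ).1
    exact (h d).2 ⟨hd, by rwa [occupied_eq_of_apex_eq hd]⟩

theorem eq_of_isCritical {c d : Cell n p q} (hM : ∀ S, IsIndepSetMatching S (M S))
    (h : c.apex = d.apex) (hc : IsCritical (MatchedBy M) c) (hd : IsCritical (MatchedBy M) d) :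
    c = d := by
  have hd' := isCritical_extensions hM hd
  have hdi := d.extensions_mem_apexIndepSets
  rw [← occupied_eq_of_apex_eq h] at hd' hdi
  exact eq_of_extensions_eq h ((hM _).unmatched _ c.extensions_mem_apexIndepSets _ hdi
    (isCritical_extensions hM hc) hd')

theorem MatchedBy.relabel (π : Equiv.Perm (Fin n)) {f e : Cell n p q} (h : MatchedBy M f e) :
    MatchedBy M (f.relabel π) (e.relabel π) := by
  refine ⟨by rw [apex_relabel, apex_relabel, h.1], ?_⟩
  rw [occupied_relabel, extensions_relabel, extensions_relabel]
  exact h.2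

end Cell

end HardSquares

theorem theorem4p1 (n p q : ℕ) (hp : 1 ≤ p) (hq : 1 ≤ q) (hn : n ≤ p * q) :
    -- every apex graph is a disjoint union of paths
    (∀ a : Cell n p q, IsDisjointUnionOfPaths (apexGraph a.occupied)) ∧
    -- the cells with a given apex correspond to the independent sets of the apex graph,
    -- the face relation corresponding to inclusion
    (∀ a : Cell n p q, a.dim = 0 →
      Set.BijOn Cell.extensions {e | e.apex = a} (apexIndepSets a.occupied) ∧
      ∀ f e : Cell n p q, f.apex = a → e.apex = a →
        (f.IsFace e ↔ f.extensions ⊆ e.extensions)) ∧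
    -- the discrete gradient vector field
    ∃ V : Cell n p q → Cell n p q → Prop,
      IsDiscreteGradient Cell.IsFace Cell.dim V ∧
      (∀ f e, V f e → f.apex = e.apex) ∧
      (∀ c d, c.apex = d.apex → IsCritical V c → IsCritical V d → c = d) ∧
      (∀ (π : Equiv.Perm (Fin n)) f e, V f e → V (f.relabel π) (e.relabel π)) ∧
      -- it is built from matchings on the independent sets of the apex graphs
      ∃ μ : Finset (ℕ × ℕ) → Set EdgeMidpoint → Set EdgeMidpoint → Prop,
        (∀ S, IsIndepSetMatching S (μ S)) ∧
        ∀ f e, V f e ↔ f.apex = e.apex ∧ μ f.occupied f.extensions e.extensions := by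
  -- One matching is fixed for each location set `S`, independently of labels; this uniform choice
  -- gives equivariance.
  choose M ρ hM using exists_apexMatching
  have hM' := fun S => (hM S).isIndepSetMatching
  exact ⟨fun a => isDisjointUnionOfPaths_apexGraph a.occupied,
    fun a ha => ⟨Cell.bijOn_extensions ha, fun f e hf he =>
      Cell.isFace_iff_extensions_subset (hf.trans he.symm)⟩,
    Cell.MatchedBy M, Cell.isDiscreteGradient_matchedBy hM, fun f e h => h.1,
    fun c d => Cell.eq_of_isCritical hM', fun π f e h => h.relabel π, M, hM', fun f e => Iff.rfl⟩
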